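/- Let $\Omega\subset\mathbb R^3$ be a bounded (nonempty, connected, open) domain with smooth boundary, let $a,b>0$, $3<p<5$ and $\lambda\in\mathbb R$. Write $\|\cdot\|_q$ for the norm of $L^q(\Omega)$ and put $$\lambda_1=\inf\{\|\nabla u\|_2^2:\ u\in H_0^1(\Omega),\ \|u\|_2=1\}$$ (the principal Dirichlet eigenvalue of $-\Delta$ on $\Omega$). For $u\in H_0^1(\Omega)$ let $$J(u)=\tfrac a4\|\nabla u\|_2^4+\tfrac b2\|\nabla u\|_2^2-\tfrac\lambda2\|u\|_2^2-\tfrac1{p+1}\|u\|_{p+1}^{p+1},$$ $$I(u)=a\|\nabla u\|_2^4+b\|\nabla u\|_2^2-\lambda\|u\|_2^2-\|u\|_{p+1}^{p+1},$$ and let $$d_p=\inf\{J(u):\ u\in H_0^1(\Omega)\setminus\{0\},\ I(u)=0\},$$ $$W_p^+=\{u\in H_0^1(\Omega):\ J(u)<d_p\ \text{and}\ (I(u)>0\ \text{or}\ u=0)\}.$$ Let $u_0\in H^2(\Omega)\cap H_0^1(\Omega)$, $u_1\in H_0^1(\Omega)$ and $E(0)=\tfrac12\|u_1\|_2^2+J(u_0)$.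 Let $$u\in C([0,T_{\max});H_0^1(\Omega)\cap H^2(\Omega))\cap C^1([0,T_{\max});H_0^1(\Omega))\cap C^2([0,T_{\max});L^2(\Omega))$$ be a solution, with maximal existence time $T_{\max}\in(0,\infty]$ (that is, $u$ does not extend to a solution in this class on a longer interval $[0,T')$), of $$u_{tt}-\Big(a\int_\Omega|\nabla u|^2\,dx+b\Big)\Delta u=\lambda u+|u|^{p-1}u\quad (t>0,\ x\in\Omega),$$ $$u(0,x)=u_0(x),\quad u_t(0,x)=u_1(x)\quad (x\in\Omega),\qquad u(t,x)=0\quad (t\ge0,\ x\in\partial\Omega).$$ Suppose that $\lambda\le b\lambda_1$, $u_0\in W_p^+$ and $E(0)<d_p$. Then there exists a constant $K_3>0$ such that $$\|u_t(t)\|_2+\|\nabla u(t)\|_2\le K_3\qquad\text{for all } t\in[0,T_{\max}).$$ -/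

import Mathlib

open MeasureTheory
open scoped ContDiff

noncomputable section

namespace Kirchhoff

/-- Euclidean space `ℝ³`. -/
abbrev E3 : Type := EuclideanSpace ℝ (Fin 3)

/-- `Ω` is an open bounded domain (nonempty, connected) of `ℝ³` with smooth boundary: near each
boundary point, `Ω` is the sublevel set `{ρ < 0}` of a smooth function `ρ` whose differential at
that point does not vanish. -/
structure IsSmoothBoundedDomain (Ω : Set E3) : Prop where
  isOpen : IsOpen Ω
  isConnected : IsConnected Ω
  isBounded : Bornology.IsBounded Ω
  smooth_boundary : ∀ x ∈ frontier Ω, ∃ (U : Set E3) (ρ : E3 → ℝ), IsOpen U ∧ x ∈ U ∧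
    ContDiffOn ℝ ∞ ρ U ∧ fderiv ℝ ρ x ≠ 0 ∧ Ω ∩ U = {y ∈ U | ρ y < 0}

/-- Lebesgue measure on `Ω`. -/
abbrev vol (Ω : Set E3) : Measure E3 := (volume : Measure E3).restrict Ω

/-- `L²(Ω)`. -/
abbrev L2 (Ω : Set E3) : Type := Lp ℝ 2 (vol Ω)

/-- `L²(Ω; ℝ³)`, square integrable vector fields; its norm is `(∫_Ω |g|² dx)^(1/2)`, with `|·|`
the Euclidean norm. -/
abbrev L2Vec (Ω : Set E3) : Type := Lp E3 2 (vol Ω)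

/-- `φ ∈ C_c^∞(Ω)`. -/
structure IsTestFunction (Ω : Set E3) (φ : E3 → ℝ) : Prop where
  contDiff : ContDiff ℝ ∞ φ
  hasCompactSupport : HasCompactSupport φ
  tsupport_subset : tsupport φ ⊆ Ω

/-- `g ∈ L²(Ω; ℝ³)` is the weak gradient of `f ∈ L²(Ω)`. -/
def IsWeakGradient (Ω : Set E3) (f : L2 Ω) (g : L2Vec Ω) : Prop :=
  ∀ φ : E3 → ℝ, IsTestFunction Ω φ →
    ∫ x in Ω, f x • gradient φ x = - ∫ x in Ω, φ x • g x

/-- `H¹₀(Ω)`, the closure of `C_c^∞(Ω)` in the `H¹` norm. A function `u` is represented by the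
pair `(u, ∇u) ∈ L²(Ω) × L²(Ω; ℝ³)`, so the topology is that of the `H¹` norm.
(The set of pairs `(φ, ∇φ)` below is already a linear subspace; taking its span only turns it into
a `Submodule`.) -/
def H10 (Ω : Set E3) : Submodule ℝ (L2 Ω × L2Vec Ω) :=
  (Submodule.span ℝ {w : L2 Ω × L2Vec Ω | ∃ φ : E3 → ℝ, IsTestFunction Ω φ ∧
    (w.1 : E3 → ℝ) =ᵐ[vol Ω] φ ∧ (w.2 : E3 → E3) =ᵐ[vol Ω] gradient φ}).topologicalClosure

variable {Ω : Set E3}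

/-- The function underlying an element of `H¹₀(Ω)`. -/
def toL2 (u : H10 Ω) : L2 Ω := u.1.1

/-- The weak gradient of an element of `H¹₀(Ω)`; thus `‖grad u‖` is the Dirichlet norm `‖∇u‖₂`. -/
def grad (u : H10 Ω) : L2Vec Ω := u.1.2

/-- The `i`-th coordinate of an `L²` vector field. -/
def coord (i : Fin 3) (g : L2Vec Ω) : L2 Ω :=
  (EuclideanSpace.proj i : E3 →L[ℝ] ℝ).compLp g

/-- `D` is the weak Hessian of `u ∈ H¹₀(Ω)`: `D i = ∇(∂ᵢu)` weakly, with `D i ∈ L²(Ω; ℝ³)`. -/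
def HasHessian (u : H10 Ω) (D : Fin 3 → L2Vec Ω) : Prop :=
  ∀ i, IsWeakGradient Ω (coord i (grad u)) (D i)

/-- `u ∈ H²(Ω)`, for `u ∈ H¹₀(Ω)`. -/
def MemH2 (u : H10 Ω) : Prop := ∃ D : Fin 3 → L2Vec Ω, HasHessian u D

/-- The trace of a Hessian; it is `Δu` when `D` is the Hessian of `u`. -/
def laplacian (D : Fin 3 → L2Vec Ω) : L2 Ω := ∑ i, coord i (D i)

/-- The principal Dirichlet eigenvalue
`λ₁ = inf {‖∇u‖₂² : u ∈ H¹₀(Ω), ‖u‖₂ = 1}` of `-Δ` on `Ω`. -/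
def lambda1 (Ω : Set E3) : ℝ :=
  sInf {r : ℝ | ∃ u : H10 Ω, ‖toL2 u‖ = 1 ∧ r = ‖grad u‖ ^ 2}

/-- `J(u) = a/4 ‖∇u‖₂⁴ + b/2 ‖∇u‖₂² - λ/2 ‖u‖₂² - 1/(p+1) ‖u‖_{p+1}^{p+1}`. -/
def J (a b lam p : ℝ) (u : H10 Ω) : ℝ :=
  a / 4 * ‖grad u‖ ^ 4 + b / 2 * ‖grad u‖ ^ 2 - lam / 2 * ‖toL2 u‖ ^ 2
    - 1 / (p + 1) * ∫ x in Ω, |toL2 u x| ^ (p + 1)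

/-- The Nehari functional
`I(u) = a ‖∇u‖₂⁴ + b ‖∇u‖₂² - λ ‖u‖₂² - ‖u‖_{p+1}^{p+1}`. -/
def I (a b lam p : ℝ) (u : H10 Ω) : ℝ :=
  a * ‖grad u‖ ^ 4 + b * ‖grad u‖ ^ 2 - lam * ‖toL2 u‖ ^ 2
    - ∫ x in Ω, |toL2 u x| ^ (p + 1)

/-- The Nehari manifold. -/
def nehari (Ω : Set E3) (a b lam p : ℝ) : Set (H10 Ω) := {u | u ≠ 0 ∧ I a b lam p u = 0}

/-- The inside space `{I > 0} ∪ {0}`. -/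
def nehariInside (Ω : Set E3) (a b lam p : ℝ) : Set (H10 Ω) := {u | 0 < I a b lam p u} ∪ {0}

/-- The depth `d_p` of the potential well. -/
def depth (Ω : Set E3) (a b lam p : ℝ) : ℝ := sInf (J a b lam p '' nehari Ω a b lam p)

/-- The stable set (potential well) `W_p⁺`. -/
def stableSet (Ω : Set E3) (a b lam p : ℝ) : Set (H10 Ω) :=
  {u | J a b lam p u < depth Ω a b lam p} ∩ nehariInside Ω a b lam p

/-- The energy `½ ‖v‖₂² + J(u)` of the state `(u, v)`; at the initial data it is `E(0)`. -/
def energy (a b lam p : ℝ) (u v : H10 Ω) : ℝ := 1 / 2 * ‖toL2 v‖ ^ 2 + J a b lam p u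

/-- The time interval `[0, T)`, where `T` may be `+∞`. -/
def timeInterval (T : EReal) : Set ℝ := {t : ℝ | 0 ≤ t ∧ (t : EReal) < T}

/-- `u_t`, as an element of `H¹₀(Ω)` (one-sided at `t = 0`). -/
def velocity (T : EReal) (u : ℝ → H10 Ω) (t : ℝ) : H10 Ω := derivWithin u (timeInterval T) t

/-- `u_tt`, as an element of `L²(Ω)`. -/
def acceleration (T : EReal) (u : ℝ → H10 Ω) (t : ℝ) : L2 Ω :=
  iteratedDerivWithin 2 (fun s => toL2 (u s)) (timeInterval T) t

/-- `u` is a solution on `[0, T)`, in the class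
`C([0,T); H¹₀ ∩ H²) ∩ C¹([0,T); H¹₀) ∩ C²([0,T); L²)`, of
`u_tt - (a ∫_Ω |∇u|² dx + b) Δu = λ u + |u|^{p-1} u` with `u = 0` on the boundary and
`u(0) = u₀`, `u_t(0) = u₁`. The values of `u` outside `[0, T)` play no role. -/
structure IsSolution (a b lam p : ℝ) (u₀ u₁ : H10 Ω) (T : EReal) (u : ℝ → H10 Ω) : Prop where
  T_pos : 0 < T
  contDiffOn_H10 : ContDiffOn ℝ 1 u (timeInterval T)
  contDiffOn_L2 : ContDiffOn ℝ 2 (fun t => toL2 (u t)) (timeInterval T)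
  init_pos : u 0 = u₀
  init_vel : velocity T u 0 = u₁
  /-- `u(t) ∈ H²`, with second derivatives depending continuously on `t` in `L²`, and the
  equation holds almost everywhere in `Ω` at each time `t ∈ (0, T)`. -/
  equation : ∃ D : ℝ → Fin 3 → L2Vec Ω,
    ContinuousOn D (timeInterval T) ∧
    (∀ t ∈ timeInterval T, HasHessian (u t) (D t)) ∧
    ∀ t ∈ timeInterval T, 0 < t → ∀ᵐ x ∂(vol Ω),
      acceleration T u t x - (a * ‖grad (u t)‖ ^ 2 + b) * laplacian (D t) x
        = lam * toL2 (u t) x + |toL2 (u t) x| ^ (p - 1) * toL2 (u t) x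

/-- `u` is a solution whose maximal existence time is `T`: it has no extension to a solution on a
longer interval `[0, T')`. -/
structure IsMaximalSolution (a b lam p : ℝ) (u₀ u₁ : H10 Ω) (T : EReal) (u : ℝ → H10 Ω) :
    Prop where
  isSolution : IsSolution a b lam p u₀ u₁ T u
  maximal : ∀ (T' : EReal) (v : ℝ → H10 Ω), T < T' → IsSolution a b lam p u₀ u₁ T' v →
    ¬ Set.EqOn v u (timeInterval T)

end Kirchhoff

end

/-! The energy `½ ‖u_t‖₂² + J(u)` is conserved, so `J(u(t)) ≤ E(0) < d_p` for all times, and the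
trajectory cannot leave the potential well (`mem_nehariInside_of_J_lt_depth`). To leave it, the
trajectory would have to meet a nonzero zero of `I`, where `J ≥ d_p`, or pass through `0`. Near `0`,
however, `I > 0` except at `0` itself (`exists_I_pos`), because `p + 1 > 4` makes the power term
negligible against `a ‖∇u‖₂⁴`. Hence `I(u(t)) ≥ 0`, and `J - I / (p + 1)` controls `‖∇u‖₂⁴`
(`le_J_of_I_nonneg`). Both terms of the energy are then bounded by `E(0)`.

The analytic work lies in `energy_eq`. It needs the Sobolev embedding of `H¹₀` into `L^(p+1)`
(`exists_sobolev`), differentiability of the power term on `H¹₀`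
(`exists_hasFDerivAt_integral_rpow`), and Green's formula (`inner_grad_eq_neg_inner_laplacian`),
which allows the equation to be tested with `u_t`. -/

namespace Kirchhoff

open Filter Topology

/-! ### Taylor expansion of the power functional on `L^(p+1)`. -/

section PowerFunctional

variable {α : Type*} [MeasurableSpace α] {μ : Measure α}

theorem integral_abs_rpow_eq {f : α → ℝ} {q : ℝ} (hq : 0 < q)
    (hf : MemLp f (ENNReal.ofReal q) μ) :
    ∫ x, |f x| ^ q ∂μ = (eLpNorm f (ENNReal.ofReal q) μ).toReal ^ q := by
  have hq0 : ENNReal.ofReal q ≠ 0 := by simpa using hq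
  rw [hf.eLpNorm_eq_integral_rpow_norm hq0 ENNReal.ofReal_ne_top,
    ENNReal.toReal_ofReal hq.le, ENNReal.toReal_ofReal (by positivity),
    ← Real.rpow_mul (by positivity), inv_mul_cancel₀ hq.ne', Real.rpow_one]
  simp only [Real.norm_eq_abs]

theorem integrable_abs_rpow {f : α → ℝ} {q : ℝ} (hq : 0 < q)
    (hf : MemLp f (ENNReal.ofReal q) μ) : Integrable (fun x => |f x| ^ q) μ := by
  have := hf.integrable_norm_rpow (by simpa using hq) ENNReal.ofReal_ne_top
  simpa [ENNReal.toReal_ofReal hq.le] using this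

theorem memLp_abs_rpow {f : α → ℝ} {q s : ℝ} (hs : 0 < s)
    (hf : MemLp f (ENNReal.ofReal q) μ) :
    MemLp (fun x => |f x| ^ s) (ENNReal.ofReal (q / s)) μ := by
  have := hf.norm_rpow_div (ENNReal.ofReal s)
  simpa [ENNReal.toReal_ofReal hs.le, ENNReal.ofReal_div_of_pos hs] using this

theorem holderConjugate_div {q s t : ℝ} (hs : 0 < s) (ht : 0 < t) (hst : s + t = q) :
    (q / s).HolderConjugate (q / t) := by
  subst hst
  rw [Real.holderConjugate_iff]
  constructor
  · rw [lt_div_iff₀ hs]; linarith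
  · field_simp

theorem integrable_rpow_mul_rpow {f g : α → ℝ} {q s t : ℝ} (hs : 0 < s) (ht : 0 < t)
    (hst : s + t = q) (hf : MemLp f (ENNReal.ofReal q) μ) (hg : MemLp g (ENNReal.ofReal q) μ) :
    Integrable (fun x => |f x| ^ s * |g x| ^ t) μ := by
  have : ENNReal.HolderTriple (ENNReal.ofReal (q / s)) (ENNReal.ofReal (q / t)) 1 :=
    (holderConjugate_div hs ht hst).ennrealOfReal
  exact (memLp_abs_rpow hs hf).integrable_mul (memLp_abs_rpow ht hg)

/-- Hölder with exponents `q / s` and `q / t`. The pair `(s, t) = (p, 1)` serves the first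
derivative, and `(p - 1, 2)` the quadratic remainder. -/
theorem integral_rpow_mul_rpow_le {f g : α → ℝ} {q s t : ℝ} (hs : 0 < s) (ht : 0 < t)
    (hst : s + t = q) (hf : MemLp f (ENNReal.ofReal q) μ) (hg : MemLp g (ENNReal.ofReal q) μ) :
    ∫ x, |f x| ^ s * |g x| ^ t ∂μ ≤ (eLpNorm f (ENNReal.ofReal q) μ).toReal ^ s *
      (eLpNorm g (ENNReal.ofReal q) μ).toReal ^ t := by
  have hq : 0 < q := by linarith
  refine (integral_mul_le_Lp_mul_Lq_of_nonneg (holderConjugate_div hs ht hst)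
    (Filter.Eventually.of_forall fun x => by positivity)
    (Filter.Eventually.of_forall fun x => by positivity)
    (memLp_abs_rpow hs hf) (memLp_abs_rpow ht hg)).trans_eq ?_
  have key : ∀ (r : ℝ) (_ : 0 < r) (h : α → ℝ) (_ : MemLp h (ENNReal.ofReal q) μ),
      (∫ x, (|h x| ^ r) ^ (q / r) ∂μ) ^ (1 / (q / r))
        = (eLpNorm h (ENNReal.ofReal q) μ).toReal ^ r := by
    intro r hr h hh
    simp_rw [← Real.rpow_mul (abs_nonneg _), mul_div_cancel₀ q hr.ne']
    rw [integral_abs_rpow_eq hq hh, ← Real.rpow_mul ENNReal.toReal_nonneg]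
    congr 1
    field_simp
  rw [key s hs f hf, key t ht g hg]

theorem hasDerivAt_abs_rpow_mul {p : ℝ} (hp : 2 < p) (x : ℝ) :
    HasDerivAt (fun y : ℝ => |y| ^ (p - 1) * y) (p * |x| ^ (p - 1)) x := by
  have h := (hasDerivAt_abs_rpow x (p := p - 1) (by linarith)).mul (hasDerivAt_id x)
  refine h.congr_deriv ?_
  rcases eq_or_ne x 0 with rfl | hx
  · simp [Real.zero_rpow (show p - 1 ≠ 0 by linarith)]
  · have h2 : |x| ^ (p - 1) = |x| ^ (p - 1 - 2) * (x * x) := by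
      rw [← abs_mul_abs_self x, ← sq, ← Real.rpow_natCast |x| 2,
        ← Real.rpow_add (abs_pos.2 hx)]
      norm_num
    simp only [id, mul_one]
    rw [h2]; ring

theorem hasDerivAt_abs_rpow_div {p : ℝ} (hp : 2 < p) (x : ℝ) :
    HasDerivAt (fun y : ℝ => |y| ^ (p + 1) / (p + 1)) (|x| ^ (p - 1) * x) x := by
  have h := (hasDerivAt_abs_rpow x (p := p + 1) (by linarith)).div_const (p + 1)
  refine h.congr_deriv ?_
  have : p + 1 ≠ 0 := by linarith
  rw [show p + 1 - 2 = p - 1 by ring]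
  field_simp

theorem abs_rpow_mul_sub_le {p : ℝ} (hp : 2 < p) {M x y : ℝ} (hx : |x| ≤ M) (hy : |y| ≤ M) :
    |(|y| ^ (p - 1) * y) - |x| ^ (p - 1) * x| ≤ p * M ^ (p - 1) * |y - x| := by
  have := (convex_Icc (-M) M).norm_image_sub_le_of_norm_hasDerivWithin_le
    (f := fun y : ℝ => |y| ^ (p - 1) * y) (f' := fun x => p * |x| ^ (p - 1))
    (C := p * M ^ (p - 1)) (fun z _ => (hasDerivAt_abs_rpow_mul hp z).hasDerivWithinAt)
    (fun z hz => by
      have hz' : |z| ≤ M := abs_le.2 hz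
      rw [Real.norm_of_nonneg (by positivity)]
      have : 0 ≤ p - 1 := by linarith
      gcongr) (abs_le.1 hx) (abs_le.1 hy)
  simpa [Real.norm_eq_abs] using this

/-- Second order Taylor bound for `|x| ^ (p + 1) / (p + 1)`. -/
theorem abs_rpow_taylor_le {p : ℝ} (hp : 2 < p) (x h : ℝ) :
    |(|x + h| ^ (p + 1) / (p + 1)) - |x| ^ (p + 1) / (p + 1) - |x| ^ (p - 1) * x * h|
      ≤ p * (|x| + |h|) ^ (p - 1) * |h| ^ 2 := by
  set M := |x| + |h|
  have hseg : ∀ z ∈ segment ℝ x (x + h), |z| ≤ M ∧ |z - x| ≤ |h| := by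
    intro z hz
    rw [segment_eq_image'] at hz
    obtain ⟨θ, ⟨h0, h1⟩, rfl⟩ := hz
    have : |θ * h| ≤ |h| := by
      rw [abs_mul, abs_of_nonneg h0]
      exact mul_le_of_le_one_left (abs_nonneg _) h1
    simp only [add_sub_cancel_left, smul_eq_mul]
    exact ⟨(abs_add_le _ _).trans (by simp only [M]; gcongr), this⟩
  -- Mean value inequality for the function minus its linear part at `x`; the derivative is an
  -- increment of `|z| ^ (p - 1) * z`, which is Lipschitz on `[-M, M]`.
  have := (convex_segment x (x + h)).norm_image_sub_le_of_norm_hasDerivWithin_le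
    (f := fun y : ℝ => |y| ^ (p + 1) / (p + 1) - |x| ^ (p - 1) * x * y)
    (f' := fun z => |z| ^ (p - 1) * z - |x| ^ (p - 1) * x)
    (C := p * M ^ (p - 1) * |h|)
    (fun z _ => by
      have h2 := (hasDerivAt_id z).const_mul (|x| ^ (p - 1) * x)
      rw [mul_one] at h2
      exact ((hasDerivAt_abs_rpow_div hp z).sub h2).hasDerivWithinAt)
    (fun z hz => by
      obtain ⟨h1, h2⟩ := hseg z hz
      refine (abs_rpow_mul_sub_le hp (M := M) (by simp [M]) h1).trans ?_
      gcongr)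
    (left_mem_segment ℝ x (x + h)) (right_mem_segment ℝ x (x + h))
  rw [Real.norm_eq_abs, Real.norm_eq_abs, add_sub_cancel_left] at this
  calc _ = _ := by congr 1; ring
    _ ≤ _ := this
    _ = _ := by ring

theorem abs_rpow_mul_self_mul {p : ℝ} (hp : 2 < p) (x y : ℝ) :
    |(|x| ^ (p - 1) * x * y)| = |x| ^ p * |y| ^ (1 : ℝ) := by
  rw [Real.rpow_one, abs_mul, abs_mul, abs_of_nonneg (by positivity : 0 ≤ |x| ^ (p - 1))]
  congr 1
  nth_rw 2 [← Real.rpow_one |x|]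
  rw [← Real.rpow_add' (abs_nonneg _) (by linarith), sub_add_cancel]

theorem integrable_rpow_mul_self_mul {p : ℝ} (hp : 2 < p) {f g : α → ℝ}
    (hf : MemLp f (ENNReal.ofReal (p + 1)) μ) (hg : MemLp g (ENNReal.ofReal (p + 1)) μ) :
    Integrable (fun x => |f x| ^ (p - 1) * f x * g x) μ := by
  refine (integrable_rpow_mul_rpow (s := p) (t := 1) (by linarith) one_pos rfl hf hg).mono
    ?_ (Filter.Eventually.of_forall fun x => ?_)
  · have hf' := hf.1.aemeasurable
    exact ((hf'.abs.pow_const (p - 1)).mul hf' |>.mul hg.1.aemeasurable).aestronglyMeasurable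
  · rw [Real.norm_eq_abs, abs_rpow_mul_self_mul hp]
    exact le_abs_self _

theorem abs_integral_rpow_mul_self_mul_le {p : ℝ} (hp : 2 < p) {f g : α → ℝ}
    (hf : MemLp f (ENNReal.ofReal (p + 1)) μ) (hg : MemLp g (ENNReal.ofReal (p + 1)) μ) :
    |∫ x, |f x| ^ (p - 1) * f x * g x ∂μ| ≤
      (eLpNorm f (ENNReal.ofReal (p + 1)) μ).toReal ^ p *
        (eLpNorm g (ENNReal.ofReal (p + 1)) μ).toReal := by
  have h := integral_rpow_mul_rpow_le (s := p) (t := 1) (by linarith) one_pos rfl hf hg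
  rw [Real.rpow_one] at h
  refine abs_integral_le_integral_abs.trans (le_trans (le_of_eq ?_) h)
  congr 1
  ext x
  exact abs_rpow_mul_self_mul hp _ _

/-- The functional `f ↦ ∫ |f| ^ (p + 1) / (p + 1)` is differentiable on `L ^ (p + 1)`, with a
quadratic remainder. -/
theorem abs_integral_taylor_le {p : ℝ} (hp : 2 < p) {f g : α → ℝ}
    (hf : MemLp f (ENNReal.ofReal (p + 1)) μ) (hg : MemLp g (ENNReal.ofReal (p + 1)) μ) :
    |1 / (p + 1) * (∫ x, |f x + g x| ^ (p + 1) ∂μ) - 1 / (p + 1) * (∫ x, |f x| ^ (p + 1) ∂μ)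
        - ∫ x, |f x| ^ (p - 1) * f x * g x ∂μ| ≤
      p * ((eLpNorm f (ENNReal.ofReal (p + 1)) μ).toReal +
        (eLpNorm g (ENNReal.ofReal (p + 1)) μ).toReal) ^ (p - 1) *
        (eLpNorm g (ENNReal.ofReal (p + 1)) μ).toReal ^ 2 := by
  have hq : 0 < p + 1 := by linarith
  have hfg := integrable_abs_rpow hq (hf.add hg)
  simp only [Pi.add_apply] at hfg
  have hfi := integrable_abs_rpow hq hf
  have hfgi := integrable_rpow_mul_self_mul hp hf hg
  have hM : MemLp (fun x => |f x| + |g x|) (ENNReal.ofReal (p + 1)) μ := hf.abs.add hg.abs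
  have hRi := integrable_rpow_mul_rpow (s := p - 1) (t := 2) (by linarith) two_pos (by ring) hM hg
  have hR := integral_rpow_mul_rpow_le (s := p - 1) (t := 2) (by linarith) two_pos (by ring) hM hg
  have hd : Integrable (fun x => 1 / (p + 1) * |f x + g x| ^ (p + 1)
      - 1 / (p + 1) * |f x| ^ (p + 1)) μ := (hfg.const_mul _).sub (hfi.const_mul _)
  rw [← integral_const_mul, ← integral_const_mul, ← integral_sub (hfg.const_mul _)
    (hfi.const_mul _), ← integral_sub hd hfgi]
  calc _ ≤ ∫ x, p * (|(|f x| + |g x|)| ^ (p - 1) * |g x| ^ (2 : ℝ)) ∂μ := by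
        refine abs_integral_le_integral_abs.trans (integral_mono
          (hd.sub hfgi).abs (hRi.const_mul _) fun x => ?_)
        have := abs_rpow_taylor_le hp (f x) (g x)
        rw [abs_of_nonneg (by positivity : 0 ≤ |f x| + |g x|), Real.rpow_two, ← mul_assoc]
        rwa [one_div_mul_eq_div, one_div_mul_eq_div]
    _ ≤ p * ((eLpNorm (fun x => |f x| + |g x|) (ENNReal.ofReal (p + 1)) μ).toReal ^ (p - 1) *
        (eLpNorm g (ENNReal.ofReal (p + 1)) μ).toReal ^ (2 : ℝ)) := by
        rw [integral_const_mul]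
        gcongr
    _ ≤ _ := by
        rw [Real.rpow_two, ← mul_assoc]
        have h1 : (eLpNorm (fun x => |f x| + |g x|) (ENNReal.ofReal (p + 1)) μ).toReal ≤
            (eLpNorm f (ENNReal.ofReal (p + 1)) μ).toReal +
            (eLpNorm g (ENNReal.ofReal (p + 1)) μ).toReal := by
          rw [← ENNReal.toReal_add hf.2.ne hg.2.ne]
          refine ENNReal.toReal_mono (ENNReal.add_ne_top.2 ⟨hf.2.ne, hg.2.ne⟩) ?_
          have := eLpNorm_add_le hf.1.norm hg.1.norm (p := ENNReal.ofReal (p + 1)) (μ := μ)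
            (by rw [ENNReal.one_le_ofReal]; linarith)
          rw [eLpNorm_norm, eLpNorm_norm] at this
          exact this
        have : 0 ≤ p - 1 := by linarith
        gcongr

end PowerFunctional

/-! ### Sobolev inequality and Green's formula, by density of test functions. -/

theorem norm_gradient_eq (φ : E3 → ℝ) (x : E3) : ‖gradient φ x‖ = ‖fderiv ℝ φ x‖ := by
  simp [gradient]

/-- Sobolev inequality for test functions on a bounded set. -/
theorem exists_sobolev_testFunction {Ω : Set E3} (hb : Bornology.IsBounded Ω)
    {q : ℝ} (hq : 0 < q) (hq6 : q ≤ 6) :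
    ∃ C : NNReal, ∀ φ : E3 → ℝ, IsTestFunction Ω φ →
      eLpNorm φ (ENNReal.ofReal q) (vol Ω) ≤ C * eLpNorm (gradient φ) 2 (vol Ω) := by
  refine ⟨eLpNormLESNormFDerivOfLeConst ℝ (volume : Measure E3) Ω 2 q.toNNReal,
    fun φ hφ => ?_⟩
  have hsupp : Function.support φ ⊆ Ω := (subset_tsupport φ).trans hφ.tsupport_subset
  have h := eLpNorm_le_eLpNorm_fderiv_of_le (μ := (volume : Measure E3)) (u := φ) (s := Ω)
    (p := 2) (q := q.toNNReal) (hφ.contDiff.of_le (by exact_mod_cast le_top)) hsupp (by norm_num)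
    (by rw [finrank_euclideanSpace_fin]; norm_num)
    (by
      rw [finrank_euclideanSpace_fin, Real.coe_toNNReal _ hq.le]
      -- The critical exponent in dimension 3 is `6`, since `1/2 - 1/3 = 1/6`.
      have : (6 : ℝ)⁻¹ ≤ q⁻¹ := inv_anti₀ hq hq6
      norm_num at this ⊢
      linarith) hb
  have hgrad : eLpNorm (fderiv ℝ φ) 2 (volume : Measure E3) = eLpNorm (gradient φ) 2 (vol Ω) := by
    have h1 : eLpNorm (fderiv ℝ φ) 2 (volume : Measure E3) = eLpNorm (gradient φ) 2 volume :=
      eLpNorm_congr_norm_ae (Eventually.of_forall fun x => (norm_gradient_eq φ x).symm)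
    rw [h1]
    refine (eLpNorm_restrict_eq_of_support_subset ?_).symm
    intro x hx
    apply hφ.tsupport_subset
    apply support_fderiv_subset ℝ
    rw [Function.mem_support] at hx ⊢
    rwa [← norm_ne_zero_iff, ← norm_gradient_eq, norm_ne_zero_iff]
  calc eLpNorm φ (ENNReal.ofReal q) (vol Ω) ≤ eLpNorm φ (ENNReal.ofReal q) volume :=
        eLpNorm_mono_measure _ Measure.restrict_le_self
    _ ≤ _ := h
    _ = _ := by rw [← hgrad]; rfl

theorem IsTestFunction.zero {Ω : Set E3} : IsTestFunction Ω 0 where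
  contDiff := contDiff_const
  hasCompactSupport := .zero
  tsupport_subset := by simp [tsupport]

theorem IsTestFunction.add {Ω : Set E3} {φ ψ : E3 → ℝ} (hφ : IsTestFunction Ω φ)
    (hψ : IsTestFunction Ω ψ) : IsTestFunction Ω (φ + ψ) where
  contDiff := hφ.contDiff.add hψ.contDiff
  hasCompactSupport := hφ.hasCompactSupport.add hψ.hasCompactSupport
  tsupport_subset := (tsupport_add φ ψ).trans
    (Set.union_subset hφ.tsupport_subset hψ.tsupport_subset)

theorem IsTestFunction.smul {Ω : Set E3} {φ : E3 → ℝ} (c : ℝ) (hφ : IsTestFunction Ω φ) :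
    IsTestFunction Ω (c • φ) where
  contDiff := hφ.contDiff.const_smul c
  hasCompactSupport := hφ.hasCompactSupport.smul_left
  tsupport_subset := (tsupport_smul_subset_right (fun _ => c) φ).trans hφ.tsupport_subset

theorem IsTestFunction.differentiable {Ω : Set E3} {φ : E3 → ℝ} (hφ : IsTestFunction Ω φ) :
    Differentiable ℝ φ :=
  hφ.contDiff.differentiable (by simp)

/-- The generators are already stable under linear combinations, so density arguments may
approximate by a single test function. -/
theorem exists_testFunction_of_mem_span {Ω : Set E3} {w : L2 Ω × L2Vec Ω}
    (hw : w ∈ Submodule.span ℝ {w : L2 Ω × L2Vec Ω | ∃ φ : E3 → ℝ, IsTestFunction Ω φ ∧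
      (w.1 : E3 → ℝ) =ᵐ[vol Ω] φ ∧ (w.2 : E3 → E3) =ᵐ[vol Ω] gradient φ}) :
    ∃ φ : E3 → ℝ, IsTestFunction Ω φ ∧
      (w.1 : E3 → ℝ) =ᵐ[vol Ω] φ ∧ (w.2 : E3 → E3) =ᵐ[vol Ω] gradient φ := by
  induction hw using Submodule.span_induction with
  | mem x h => exact h
  | zero =>
    refine ⟨0, .zero, Lp.coeFn_zero _ _ _, (Lp.coeFn_zero _ _ _).trans ?_⟩
    refine Eventually.of_forall fun x => ?_
    simp [gradient]
  | add x y _ _ hx hy =>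
    obtain ⟨φ, hφ, h1, h2⟩ := hx
    obtain ⟨ψ, hψ, h3, h4⟩ := hy
    refine ⟨φ + ψ, hφ.add hψ, (Lp.coeFn_add _ _).trans (h1.add h3),
      (Lp.coeFn_add _ _).trans ((h2.add h4).trans (Eventually.of_forall fun x => ?_))⟩
    simp [gradient, fderiv_add (hφ.differentiable x) (hψ.differentiable x)]
  | smul c x _ hx =>
    obtain ⟨φ, hφ, h1, h2⟩ := hx
    refine ⟨c • φ, hφ.smul c, (Lp.coeFn_smul _ _).trans (h1.const_smul c),
      (Lp.coeFn_smul _ _).trans ((h2.const_smul c).trans (Eventually.of_forall fun x => ?_))⟩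
    simp [gradient, fderiv_const_smul (hφ.differentiable x)]

theorem eLpNorm_grad {Ω : Set E3} (g : L2Vec Ω) :
    eLpNorm g 2 (vol Ω) = ENNReal.ofReal ‖g‖ := by
  rw [Lp.norm_def, ENNReal.ofReal_toReal (Lp.eLpNorm_ne_top g)]

/-- Sobolev inequality on `H¹₀(Ω)`. -/
theorem exists_sobolev {Ω : Set E3} (hb : Bornology.IsBounded Ω)
    {q : ℝ} (hq : 0 < q) (hq6 : q ≤ 6) :
    ∃ C : ℝ, 0 < C ∧ ∀ u : H10 Ω, MemLp (toL2 u) (ENNReal.ofReal q) (vol Ω) ∧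
      (eLpNorm (toL2 u) (ENNReal.ofReal q) (vol Ω)).toReal ≤ C * ‖grad u‖ := by
  obtain ⟨C, hC⟩ := exists_sobolev_testFunction hb hq hq6
  have key : ∀ u : H10 Ω, eLpNorm (toL2 u) (ENNReal.ofReal q) (vol Ω) ≤
      C * ENNReal.ofReal ‖grad u‖ := by
    intro u
    obtain ⟨w, hw, hlim⟩ := mem_closure_iff_seq_limit.1 u.2
    have hw' : ∀ n, eLpNorm (w n).1 (ENNReal.ofReal q) (vol Ω) ≤
        C * ENNReal.ofReal ‖(w n).2‖ := by
      intro n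
      obtain ⟨φ, hφ, h1, h2⟩ := exists_testFunction_of_mem_span (hw n)
      rw [← eLpNorm_grad, eLpNorm_congr_ae h1, eLpNorm_congr_ae h2]
      exact hC φ hφ
    have hl1 : Tendsto (fun n => (w n).1) atTop (𝓝 (toL2 u)) :=
      (continuous_fst.tendsto _).comp hlim
    have hl2 : Tendsto (fun n => (w n).2) atTop (𝓝 (grad u)) :=
      (continuous_snd.tendsto _).comp hlim
    -- An a.e. convergent subsequence and Fatou carry the bound to the limit; convergence in `L^q`
    -- is not needed.
    obtain ⟨ns, hns, hae⟩ := (tendstoInMeasure_of_tendsto_Lp hl1).exists_seq_tendsto_ae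
    refine (Lp.eLpNorm_lim_le_liminf_eLpNorm (fun n => Lp.aestronglyMeasurable _) _ hae).trans ?_
    have hl3 : Tendsto (fun n => (C : ENNReal) * ENNReal.ofReal ‖(w (ns n)).2‖) atTop
        (𝓝 (C * ENNReal.ofReal ‖grad u‖)) :=
      ENNReal.Tendsto.const_mul
        (ENNReal.tendsto_ofReal ((hl2.comp hns.tendsto_atTop).norm)) (Or.inr ENNReal.coe_ne_top)
    rw [← hl3.liminf_eq]
    exact liminf_le_liminf (Eventually.of_forall fun n => hw' (ns n))
  refine ⟨C + 1, by positivity, fun u => ⟨⟨Lp.aestronglyMeasurable _, (key u).trans_lt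
    (ENNReal.mul_lt_top ENNReal.coe_lt_top ENNReal.ofReal_lt_top)⟩, ?_⟩⟩
  have := ENNReal.toReal_mono
    (ENNReal.mul_lt_top ENNReal.coe_lt_top ENNReal.ofReal_lt_top).ne (key u)
  rw [ENNReal.toReal_mul, ENNReal.toReal_ofReal (norm_nonneg _), ENNReal.coe_toReal] at this
  nlinarith [norm_nonneg (grad u)]

/-- Take the `i`-th coordinate of the weak gradient identity for `∂ᵢu` and sum over `i`. -/
theorem integral_grad_inner_of_hasHessian {Ω : Set E3} {u : H10 Ω} {D : Fin 3 → L2Vec Ω}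
    (hD : HasHessian u D) {w : L2 Ω × L2Vec Ω} {φ : E3 → ℝ} (hφ : IsTestFunction Ω φ)
    (h1 : (w.1 : E3 → ℝ) =ᵐ[vol Ω] φ) (h2 : (w.2 : E3 → E3) =ᵐ[vol Ω] gradient φ) :
    inner ℝ (grad u) w.2 = - inner ℝ (laplacian D) w.1 := by
  have hcoord : ∀ i, inner ℝ (coord i (grad u)) (coord i w.2)
      = - inner ℝ (coord i (D i)) w.1 := by
    intro i
    have hg : MemLp (gradient φ) 2 (vol Ω) := (Lp.memLp w.2).ae_eq h2
    have hf : MemLp φ 2 (vol Ω) := (Lp.memLp w.1).ae_eq h1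
    have hint1 : Integrable (fun x => coord i (grad u) x • gradient φ x) (vol Ω) :=
      memLp_one_iff_integrable.1 (hg.smul (Lp.memLp (coord i (grad u))))
    have hint2 : Integrable (fun x => φ x • D i x) (vol Ω) :=
      memLp_one_iff_integrable.1 ((Lp.memLp (D i)).smul hf)
    have h := congrArg (EuclideanSpace.proj i : E3 →L[ℝ] ℝ) (hD i φ hφ)
    rw [map_neg, ← ContinuousLinearMap.integral_comp_comm _ hint1,
      ← ContinuousLinearMap.integral_comp_comm _ hint2] at h
    rw [L2.inner_def, L2.inner_def]
    refine Eq.trans (integral_congr_ae ?_) (h.trans (congrArg _ (integral_congr_ae ?_)))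
    · filter_upwards [h2, (EuclideanSpace.proj i : E3 →L[ℝ] ℝ).coeFn_compLp w.2] with x hx hx2
      have : coord i w.2 x = gradient φ x i := by rw [coord, hx2, hx]; rfl
      simp [this, mul_comm]
    · filter_upwards [h1, (EuclideanSpace.proj i : E3 →L[ℝ] ℝ).coeFn_compLp (D i)] with x hx hx2
      have : coord i (D i) x = D i x i := by rw [coord, hx2]; rfl
      simp [this, hx]
  rw [laplacian, sum_inner, ← Finset.sum_neg_distrib, ← Finset.sum_congr rfl fun i _ => hcoord i]
  simp only [L2.inner_def]
  rw [← integral_finsetSum _ fun i _ => L2.integrable_inner _ _]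
  refine integral_congr_ae ?_
  have := fun (i : Fin 3) => (EuclideanSpace.proj i : E3 →L[ℝ] ℝ).coeFn_compLp w.2
  have h3 := ae_all_iff.2 this
  have := fun (i : Fin 3) => (EuclideanSpace.proj i : E3 →L[ℝ] ℝ).coeFn_compLp (grad u)
  have h4 := ae_all_iff.2 this
  filter_upwards [h3, h4] with x hx3 hx4
  rw [PiLp.inner_apply]
  refine Finset.sum_congr rfl fun i _ => ?_
  rw [coord, coord, hx3, hx4]
  rfl

/-- Green's formula for `u ∈ H² ∩ H¹₀` and `v ∈ H¹₀`. -/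
theorem inner_grad_eq_neg_inner_laplacian {Ω : Set E3} {u : H10 Ω} {D : Fin 3 → L2Vec Ω}
    (hD : HasHessian u D) (v : H10 Ω) :
    inner ℝ (grad u) (grad v) = - inner ℝ (laplacian D) (toL2 v) := by
  -- Both sides are continuous in the pair `w`, so the identity passes to the closure of the test
  -- functions.
  have hcl : IsClosed {w : L2 Ω × L2Vec Ω | inner ℝ (grad u) w.2 = - inner ℝ (laplacian D) w.1} :=
    isClosed_eq (by fun_prop) (by fun_prop)
  refine closure_minimal (fun w hw => ?_) hcl v.2
  obtain ⟨φ, hφ, h1, h2⟩ := exists_testFunction_of_mem_span hw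
  exact integral_grad_inner_of_hasHessian hD hφ h1 h2

/-! ### Regularity of `J` and `I` on `H¹₀`. -/

section FunctionSpace

variable {Ω : Set E3}

/-- The inclusion `H¹₀(Ω) → L²(Ω)` as a continuous linear map. -/
noncomputable def toL2CLM (Ω : Set E3) : H10 Ω →L[ℝ] L2 Ω :=
  (ContinuousLinearMap.fst ℝ (L2 Ω) (L2Vec Ω)).comp (H10 Ω).subtypeL

/-- The weak gradient on `H¹₀(Ω)` as a continuous linear map. -/
noncomputable def gradCLM (Ω : Set E3) : H10 Ω →L[ℝ] L2Vec Ω :=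
  (ContinuousLinearMap.snd ℝ (L2 Ω) (L2Vec Ω)).comp (H10 Ω).subtypeL

theorem toL2CLM_apply (u : H10 Ω) : toL2CLM Ω u = toL2 u := rfl

theorem gradCLM_apply (u : H10 Ω) : gradCLM Ω u = grad u := rfl

theorem continuous_toL2 : Continuous (toL2 : H10 Ω → L2 Ω) := (toL2CLM Ω).continuous

theorem continuous_grad : Continuous (grad : H10 Ω → L2Vec Ω) := (gradCLM Ω).continuous

theorem norm_grad_le (u : H10 Ω) : ‖grad u‖ ≤ ‖u‖ := norm_snd_le u.1

theorem coeFn_toL2_add (u v : H10 Ω) :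
    (toL2 (u + v) : E3 → ℝ) =ᵐ[vol Ω] fun x => toL2 u x + toL2 v x :=
  Lp.coeFn_add (toL2 u) (toL2 v)

theorem coeFn_toL2_smul (c : ℝ) (u : H10 Ω) :
    (toL2 (c • u) : E3 → ℝ) =ᵐ[vol Ω] fun x => c * toL2 u x :=
  Lp.coeFn_smul c (toL2 u)

/-- The functional `u ↦ ‖u‖_{p+1}^{p+1} / (p + 1)` is differentiable on `H¹₀(Ω)`. -/
theorem exists_hasFDerivAt_integral_rpow (hb : Bornology.IsBounded Ω) {p : ℝ} (hp3 : 3 < p)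
    (hp5 : p < 5) (u : H10 Ω) :
    ∃ L : H10 Ω →L[ℝ] ℝ,
      HasFDerivAt (fun v : H10 Ω => 1 / (p + 1) * ∫ x in Ω, |toL2 v x| ^ (p + 1)) L u ∧
      ∀ v, L v = ∫ x in Ω, |toL2 u x| ^ (p - 1) * toL2 u x * toL2 v x := by
  have hp : 2 < p := by linarith
  obtain ⟨C, hC0, hC⟩ := exists_sobolev hb (q := p + 1) (by linarith) (by linarith)
  have hint : ∀ v : H10 Ω, Integrable
      (fun x => |toL2 u x| ^ (p - 1) * toL2 u x * toL2 v x) (vol Ω) :=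
    fun v => integrable_rpow_mul_self_mul hp (hC u).1 (hC v).1
  let L₀ : H10 Ω →ₗ[ℝ] ℝ :=
    { toFun := fun v => ∫ x in Ω, |toL2 u x| ^ (p - 1) * toL2 u x * toL2 v x
      map_add' := fun v w => by
        rw [← integral_add (hint v) (hint w)]
        refine integral_congr_ae ?_
        filter_upwards [coeFn_toL2_add v w] with x hx
        rw [hx]; ring
      map_smul' := fun c v => by
        rw [RingHom.id_apply, smul_eq_mul, ← integral_const_mul]
        refine integral_congr_ae ?_
        filter_upwards [coeFn_toL2_smul c v] with x hx
        rw [hx]; ring }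
  have hN : ∀ v : H10 Ω,
      (eLpNorm (toL2 v) (ENNReal.ofReal (p + 1)) (vol Ω)).toReal ≤ C * ‖v‖ := fun v =>
    (hC v).2.trans (by gcongr; exact norm_grad_le v)
  let L : H10 Ω →L[ℝ] ℝ := L₀.mkContinuous
    ((eLpNorm (toL2 u) (ENNReal.ofReal (p + 1)) (vol Ω)).toReal ^ p * C) fun v => by
      refine (abs_integral_rpow_mul_self_mul_le hp (hC u).1 (hC v).1).trans ?_
      rw [mul_assoc]
      gcongr
      exact hN v
  refine ⟨L, ?_, fun v => rfl⟩
  rw [hasFDerivAt_iff_isLittleO_nhds_zero]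
  refine Asymptotics.IsBigO.trans_isLittleO (g := fun h : H10 Ω => ‖h‖ ^ 2) ?_
    (Asymptotics.isLittleO_norm_pow_id one_lt_two)
  -- For `‖h‖ ≤ 1` the `L^(p+1)` norms of `u` and `h` are at most `C * ‖u‖` and `C`, which freezes
  -- the base of the power in the remainder.
  refine Asymptotics.IsBigO.of_bound (p * (C * ‖u‖ + C) ^ (p - 1) * C ^ 2) ?_
  filter_upwards [Metric.ball_mem_nhds (0 : H10 Ω) one_pos] with h hh
  have hh1 : ‖h‖ ≤ 1 := (mem_ball_zero_iff.1 hh).le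
  have hsum : ∫ x in Ω, |toL2 (u + h) x| ^ (p + 1) = ∫ x in Ω, |toL2 u x + toL2 h x| ^ (p + 1) :=
    integral_congr_ae <| by
      filter_upwards [coeFn_toL2_add u h] with x hx
      rw [hx]
  rw [hsum]
  refine (abs_integral_taylor_le hp (hC u).1 (hC h).1).trans ?_
  rw [Real.norm_of_nonneg (by positivity), mul_assoc _ (C ^ 2), ← mul_pow]
  have : 0 ≤ p - 1 := by linarith
  have h1 := hN u
  have h2 := hN h
  have h3 : C * ‖h‖ ≤ C := mul_le_of_le_one_right hC0.le hh1
  have h4 := h2.trans h3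
  gcongr

theorem continuous_integral_rpow (hb : Bornology.IsBounded Ω) {p : ℝ} (hp3 : 3 < p)
    (hp5 : p < 5) : Continuous fun v : H10 Ω => ∫ x in Ω, |toL2 v x| ^ (p + 1) := by
  have h : Continuous fun v : H10 Ω => 1 / (p + 1) * ∫ x in Ω, |toL2 v x| ^ (p + 1) :=
    continuous_iff_continuousAt.2 fun u =>
      (exists_hasFDerivAt_integral_rpow hb hp3 hp5 u).choose_spec.1.continuousAt
  have hp : p + 1 ≠ 0 := by linarith
  refine (h.const_mul (p + 1)).congr fun v => ?_
  field_simp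

theorem continuous_J (hb : Bornology.IsBounded Ω) (a b lam : ℝ) {p : ℝ} (hp3 : 3 < p)
    (hp5 : p < 5) : Continuous (J a b lam p : H10 Ω → ℝ) := by
  have h1 := continuous_integral_rpow hb hp3 hp5
  have h2 := continuous_grad (Ω := Ω)
  have h3 := continuous_toL2 (Ω := Ω)
  unfold J
  fun_prop

theorem continuous_I (hb : Bornology.IsBounded Ω) (a b lam : ℝ) {p : ℝ} (hp3 : 3 < p)
    (hp5 : p < 5) : Continuous (I a b lam p : H10 Ω → ℝ) := by
  have h1 := continuous_integral_rpow hb hp3 hp5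
  have h2 := continuous_grad (Ω := Ω)
  have h3 := continuous_toL2 (Ω := Ω)
  unfold I
  fun_prop

end FunctionSpace

/-! ### Geometry of the potential well. -/

section PotentialWell

variable {Ω : Set E3} {a b lam p : ℝ}

theorem lambda1_mul_norm_sq_le (u : H10 Ω) : lambda1 Ω * ‖toL2 u‖ ^ 2 ≤ ‖grad u‖ ^ 2 := by
  rcases eq_or_ne (toL2 u) 0 with h | h
  · simp only [h, norm_zero]; nlinarith [sq_nonneg ‖grad u‖]
  have hpos : 0 < ‖toL2 u‖ := norm_pos_iff.2 h
  have hle : lambda1 Ω ≤ ‖grad (‖toL2 u‖⁻¹ • u)‖ ^ 2 := by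
    refine csInf_le ⟨0, ?_⟩ ⟨‖toL2 u‖⁻¹ • u, ?_, rfl⟩
    · rintro r ⟨v, -, rfl⟩
      positivity
    · rw [← toL2CLM_apply, map_smul, toL2CLM_apply, norm_smul, norm_inv, norm_norm,
        inv_mul_cancel₀ hpos.ne']
  rw [← gradCLM_apply, map_smul, gradCLM_apply, norm_smul, norm_inv, norm_norm, mul_pow,
    inv_pow] at hle
  calc _ ≤ (‖toL2 u‖ ^ 2)⁻¹ * ‖grad u‖ ^ 2 * ‖toL2 u‖ ^ 2 := by gcongr
    _ = _ := by field_simp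

/-- The sole entry point of `λ ≤ b λ₁`: the quadratic parts of `I` and `J` are nonnegative and can
be dropped from lower bounds. -/
theorem mul_norm_sq_le_mul_norm_grad_sq (hb : 0 < b) (hlam : lam ≤ b * lambda1 Ω) (u : H10 Ω) :
    lam * ‖toL2 u‖ ^ 2 ≤ b * ‖grad u‖ ^ 2 :=
  calc _ ≤ b * lambda1 Ω * ‖toL2 u‖ ^ 2 := by gcongr
    _ = b * (lambda1 Ω * ‖toL2 u‖ ^ 2) := by ring
    _ ≤ _ := by gcongr; exact lambda1_mul_norm_sq_le u

theorem eq_zero_of_grad_eq_zero (hΩ : Bornology.IsBounded Ω) {u : H10 Ω} (h : grad u = 0) :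
    u = 0 := by
  obtain ⟨C, -, hC⟩ := exists_sobolev hΩ (q := 2) two_pos (by norm_num)
  have h1 := (hC u).2
  rw [h, norm_zero, mul_zero, ENNReal.ofReal_ofNat, ← Lp.norm_def] at h1
  exact Subtype.ext (Prod.ext (norm_le_zero_iff.1 h1) h)

/-- By Sobolev the power term is at most `(C ‖∇u‖₂)^(p+1)`, which is of order higher than four. -/
theorem exists_I_pos (hΩ : Bornology.IsBounded Ω) (ha : 0 < a) (hb : 0 < b) (hp3 : 3 < p)
    (hp5 : p < 5) (hlam : lam ≤ b * lambda1 Ω) :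
    ∃ δ > 0, ∀ u : H10 Ω, u ≠ 0 → ‖grad u‖ < δ → 0 < I a b lam p u := by
  obtain ⟨C, hC0, hC⟩ := exists_sobolev hΩ (q := p + 1) (by linarith) (by linarith)
  have hp : 0 < p - 3 := by linarith
  -- This `δ` solves `C ^ (p + 1) * δ ^ (p - 3) = a`.
  refine ⟨(a / C ^ (p + 1)) ^ (1 / (p - 3)), by positivity, fun u hu hlt => ?_⟩
  have hg : 0 < ‖grad u‖ := norm_pos_iff.2 fun h => hu (eq_zero_of_grad_eq_zero hΩ h)
  have h1 : ∫ x in Ω, |toL2 u x| ^ (p + 1) ≤ (C * ‖grad u‖) ^ (p + 1) := by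
    rw [integral_abs_rpow_eq (by linarith) (hC u).1]
    have := (hC u).2
    gcongr
  have h2 : ‖grad u‖ ^ (p - 3) < a / C ^ (p + 1) := by
    have := Real.rpow_lt_rpow hg.le hlt hp
    rwa [← Real.rpow_mul (by positivity), one_div_mul_cancel hp.ne', Real.rpow_one] at this
  have h3 : (C * ‖grad u‖) ^ (p + 1) = C ^ (p + 1) * ‖grad u‖ ^ (p - 3) * ‖grad u‖ ^ 4 := by
    rw [Real.mul_rpow hC0.le hg.le, mul_assoc, ← Real.rpow_natCast ‖grad u‖ 4,
      ← Real.rpow_add hg]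
    norm_num
    left
    congr 1
    ring
  have h4 : C ^ (p + 1) * ‖grad u‖ ^ (p - 3) < a := by
    rwa [lt_div_iff₀' (by positivity)] at h2
  have h5 : (C * ‖grad u‖) ^ (p + 1) < a * ‖grad u‖ ^ 4 := by
    rw [h3]; gcongr
  have h6 := mul_norm_sq_le_mul_norm_grad_sq hb hlam u
  unfold I
  linarith

/-- Subtracting `I / (p + 1)` from `J` cancels the power term and leaves the quartic term plus a
nonnegative multiple of the quadratic part. -/
theorem le_J_of_I_nonneg (hb : 0 < b) (hp3 : 3 < p) (hlam : lam ≤ b * lambda1 Ω) {u : H10 Ω}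
    (hI : 0 ≤ I a b lam p u) : a * (1 / 4 - 1 / (p + 1)) * ‖grad u‖ ^ 4 ≤ J a b lam p u := by
  have h := mul_norm_sq_le_mul_norm_grad_sq hb hlam u
  have hp : 0 < p + 1 := by linarith
  have h1 : 0 ≤ 1 / (p + 1) * I a b lam p u := by positivity
  have h2 : 1 / (p + 1) < 1 / 2 := by
    rw [div_lt_div_iff₀ hp two_pos]; linarith
  have h3 : 0 ≤ (1 / 2 - 1 / (p + 1)) * (b * ‖grad u‖ ^ 2 - lam * ‖toL2 u‖ ^ 2) :=
    mul_nonneg (by linarith) (by linarith)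
  have h4 : J a b lam p u = a * (1 / 4 - 1 / (p + 1)) * ‖grad u‖ ^ 4
      + (1 / 2 - 1 / (p + 1)) * (b * ‖grad u‖ ^ 2 - lam * ‖toL2 u‖ ^ 2)
      + 1 / (p + 1) * I a b lam p u := by
    unfold J I; ring
  linarith

theorem I_zero (hp3 : 3 < p) : I a b lam p (0 : H10 Ω) = 0 := by
  have h1 : ∫ x in Ω, |toL2 (0 : H10 Ω) x| ^ (p + 1) = 0 := by
    refine integral_eq_zero_of_ae ?_
    filter_upwards [Lp.coeFn_zero ℝ 2 (vol Ω)] with x hx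
    have : toL2 (0 : H10 Ω) x = 0 := hx
    simp [this, Real.zero_rpow (show p + 1 ≠ 0 by linarith)]
  have h2 : grad (0 : H10 Ω) = 0 := rfl
  have h3 : toL2 (0 : H10 Ω) = 0 := rfl
  rw [I, h1, h2, h3, norm_zero, norm_zero]
  ring

theorem I_nonneg_of_mem_nehariInside (hp3 : 3 < p) {u : H10 Ω}
    (hu : u ∈ nehariInside Ω a b lam p) : 0 ≤ I a b lam p u := by
  rcases hu with h | h
  · exact le_of_lt h
  · rw [Set.mem_singleton_iff.1 h, I_zero hp3]

/-- Since `I = 0` on the Nehari manifold, `J ≥ 0` there, so the real infimum is over a set bounded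
below and is a true lower bound. -/
theorem depth_le_J (ha : 0 < a) (hb : 0 < b) (hp3 : 3 < p) (hlam : lam ≤ b * lambda1 Ω)
    {u : H10 Ω} (hu : u ∈ nehari Ω a b lam p) : depth Ω a b lam p ≤ J a b lam p u := by
  refine csInf_le ⟨0, ?_⟩ ⟨u, hu, rfl⟩
  rintro _ ⟨v, hv, rfl⟩
  refine le_trans ?_ (le_J_of_I_nonneg hb hp3 hlam hv.2.ge)
  have : 1 / (p + 1) ≤ 1 / 4 := by
    rw [div_le_div_iff₀ (by linarith) (by norm_num)]; linarith
  have : 0 ≤ 1 / 4 - 1 / (p + 1) := by linarith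
  positivity

/-- A continuous curve that stays below the depth of the well does not leave the inside of the
Nehari manifold. -/
theorem mem_nehariInside_of_J_lt_depth (hΩ : Bornology.IsBounded Ω) (ha : 0 < a) (hb : 0 < b)
    (hp3 : 3 < p) (hp5 : p < 5) (hlam : lam ≤ b * lambda1 Ω) {S : Set ℝ} (hS : IsPreconnected S)
    {u : ℝ → H10 Ω} (hu : ContinuousOn u S) (hJ : ∀ t ∈ S, J a b lam p (u t) < depth Ω a b lam p)
    {t₀ : ℝ} (ht₀ : t₀ ∈ S) (h₀ : u t₀ ∈ nehariInside Ω a b lam p) {t : ℝ} (ht : t ∈ S) :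
    u t ∈ nehariInside Ω a b lam p := by
  have : PreconnectedSpace S := Subtype.preconnectedSpace hS
  obtain ⟨δ, hδ, hpos⟩ := exists_I_pos (a := a) hΩ ha hb hp3 hp5 hlam
  have hcont : Continuous fun s : S => u s := continuousOn_iff_continuous_domRestrict.1 hu
  have hIc : Continuous fun s : S => I a b lam p (u s) :=
    (continuous_I hΩ a b lam hp3 hp5).comp hcont
  let A : Set S := {s | u s ∈ nehariInside Ω a b lam p}
  -- Below the depth, `I = 0` forces `u = 0`, so being inside amounts to the closed condition `I ≥
  -- 0`.
  have hclosed : IsClosed A := by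
    have : A = {s : S | 0 ≤ I a b lam p (u s)} := by
      ext s
      refine ⟨fun hs => I_nonneg_of_mem_nehariInside hp3 hs, fun hs => ?_⟩
      rcases (show 0 ≤ I a b lam p (u s) from hs).lt_or_eq with h | h
      · exact Or.inl h
      · refine Or.inr (by_contra fun hne => ?_)
        exact (hJ s s.2).not_ge (depth_le_J ha hb hp3 hlam ⟨hne, h.symm⟩)
    rw [this]
    exact isClosed_le continuous_const hIc
  -- The only points not covered by `I > 0` are those with `u = 0`; the whole neighbourhood `‖∇u‖₂ <
  -- δ` lies inside.
  have hopen : IsOpen A := by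
    have : A = {s : S | 0 < I a b lam p (u s)} ∪ {s : S | ‖grad (u s)‖ < δ} := by
      ext s
      constructor
      · rintro (h | h)
        · exact Or.inl h
        · refine Or.inr ?_
          have h2 : grad (0 : H10 Ω) = 0 := rfl
          change ‖grad (u s)‖ < δ
          rwa [Set.mem_singleton_iff.1 h, h2, norm_zero]
      · rintro (h | h)
        · exact Or.inl h
        · by_cases hz : u s = 0
          · exact Or.inr hz
          · exact Or.inl (hpos _ hz h)
    rw [this]
    exact (isOpen_lt continuous_const hIc).union
      (isOpen_lt (continuous_grad.comp hcont).norm continuous_const)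
  have huniv : A = Set.univ := IsClopen.eq_univ ⟨hclosed, hopen⟩ ⟨⟨t₀, ht₀⟩, h₀⟩
  have hmem : (⟨t, ht⟩ : S) ∈ A := huniv ▸ Set.mem_univ _
  exact hmem

end PotentialWell

/-! ### The time interval. -/

section TimeInterval

variable {T : EReal}

theorem ordConnected_timeInterval : (timeInterval T).OrdConnected :=
  ⟨fun _ hx _ hy _ hz => ⟨hx.1.trans hz.1, (EReal.coe_le_coe_iff.2 hz.2).trans_lt hy.2⟩⟩

theorem timeInterval_mem_nhds {t : ℝ} (ht : t ∈ timeInterval T) (h0 : 0 < t) :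
    timeInterval T ∈ 𝓝 t := by
  obtain ⟨r, htr, hrT⟩ := EReal.lt_iff_exists_real_btwn.1 ht.2
  filter_upwards [Ioo_mem_nhds h0 (EReal.coe_lt_coe_iff.1 htr)] with s hs
  exact ⟨hs.1.le, (EReal.coe_lt_coe_iff.2 hs.2).trans hrT⟩

theorem uniqueDiffOn_timeInterval (hT : 0 < T) : UniqueDiffOn ℝ (timeInterval T) := by
  refine uniqueDiffOn_convex ordConnected_timeInterval.convex ?_
  obtain ⟨r, h0r, hrT⟩ := EReal.lt_iff_exists_real_btwn.1 hT
  have h0r' : 0 < r := by exact_mod_cast h0r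
  exact ⟨r, mem_interior_iff_mem_nhds.2 (timeInterval_mem_nhds ⟨h0r'.le, hrT⟩ h0r')⟩

end TimeInterval

/-! ### Conservation of energy. -/

section Energy

variable {Ω : Set E3} {a b lam p : ℝ} {u₀ u₁ : H10 Ω} {T : EReal} {u : ℝ → H10 Ω}

namespace IsSolution

theorem continuousOn_velocity (hu : IsSolution a b lam p u₀ u₁ T u) :
    ContinuousOn (velocity T u) (timeInterval T) :=
  hu.contDiffOn_H10.continuousOn_derivWithin (uniqueDiffOn_timeInterval hu.T_pos) le_rfl

theorem hasDerivWithinAt (hu : IsSolution a b lam p u₀ u₁ T u) {t : ℝ}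
    (ht : t ∈ timeInterval T) : HasDerivWithinAt u (velocity T u t) (timeInterval T) t :=
  (hu.contDiffOn_H10.differentiableOn one_ne_zero t ht).hasDerivWithinAt

theorem derivWithin_toL2 (hu : IsSolution a b lam p u₀ u₁ T u) {t : ℝ}
    (ht : t ∈ timeInterval T) :
    derivWithin (fun s => toL2 (u s)) (timeInterval T) t = toL2 (velocity T u t) :=
  ((toL2CLM Ω).hasFDerivAt.comp_hasDerivWithinAt t (hu.hasDerivWithinAt ht)).derivWithin
    (uniqueDiffOn_timeInterval hu.T_pos t ht)

theorem hasDerivAt_toL2_velocity (hu : IsSolution a b lam p u₀ u₁ T u) {t : ℝ}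
    (ht : t ∈ timeInterval T) (h0 : 0 < t) :
    HasDerivAt (fun s => toL2 (velocity T u s)) (acceleration T u t) t := by
  have hS := uniqueDiffOn_timeInterval hu.T_pos
  have hd := (hu.contDiffOn_L2.differentiableOn_iteratedDerivWithin (m := 1)
    (by norm_num) hS t ht).hasDerivWithinAt
  rw [← iteratedDerivWithin_succ] at hd
  refine (hd.congr (fun s hs => ?_) ?_).hasDerivAt (timeInterval_mem_nhds ht h0)
  · rw [iteratedDerivWithin_one, hu.derivWithin_toL2 hs]
  · rw [iteratedDerivWithin_one, hu.derivWithin_toL2 ht]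

/-- The equation tested against `v ∈ H¹₀(Ω)`. -/
theorem weak_equation (hu : IsSolution a b lam p u₀ u₁ T u) {t : ℝ}
    (ht : t ∈ timeInterval T) (h0 : 0 < t) (v : H10 Ω) :
    inner ℝ (acceleration T u t) (toL2 v)
      + (a * ‖grad (u t)‖ ^ 2 + b) * inner ℝ (grad (u t)) (grad v)
      - lam * inner ℝ (toL2 (u t)) (toL2 v)
      = ∫ x in Ω, |toL2 (u t) x| ^ (p - 1) * toL2 (u t) x * toL2 v x := by
  obtain ⟨D, -, hD, heq⟩ := hu.equation
  set κ := a * ‖grad (u t)‖ ^ 2 + b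
  -- The equation exhibits `|u|^(p-1) u` as an element of `L²`, so its integrability needs no
  -- separate argument.
  let z : L2 Ω := acceleration T u t - κ • laplacian (D t) - lam • toL2 (u t)
  have hz : (z : E3 → ℝ) =ᵐ[vol Ω] fun x => |toL2 (u t) x| ^ (p - 1) * toL2 (u t) x := by
    filter_upwards [heq t ht h0, Lp.coeFn_sub (acceleration T u t - κ • laplacian (D t))
      (lam • toL2 (u t)), Lp.coeFn_sub (acceleration T u t) (κ • laplacian (D t)),
      Lp.coeFn_smul κ (laplacian (D t)), Lp.coeFn_smul lam (toL2 (u t))] with x h1 h2 h3 h4 h5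
    simp only [Pi.sub_apply, Pi.smul_apply, smul_eq_mul] at h2 h3 h4 h5
    rw [h2, h3, h4, h5, h1]
    ring
  have hinner : inner ℝ z (toL2 v)
      = ∫ x in Ω, |toL2 (u t) x| ^ (p - 1) * toL2 (u t) x * toL2 v x := by
    rw [L2.inner_def]
    refine integral_congr_ae ?_
    filter_upwards [hz] with x hx
    rw [RCLike.inner_apply, conj_trivial, hx, mul_comm]
  rw [← hinner, inner_grad_eq_neg_inner_laplacian (hD t ht) v]
  simp only [z, inner_sub_left, real_inner_smul_left]
  ring

/-- The chain rule produces exactly the weak equation tested with `v = u_t`, which is admissible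
because `u_t ∈ H¹₀`. -/
theorem hasDerivAt_energy (hΩ : Bornology.IsBounded Ω) (hp3 : 3 < p) (hp5 : p < 5)
    (hu : IsSolution a b lam p u₀ u₁ T u) {t : ℝ} (ht : t ∈ timeInterval T) (h0 : 0 < t) :
    HasDerivAt (fun s => energy a b lam p (u s) (velocity T u s)) 0 t := by
  have hd : HasDerivAt u (velocity T u t) t :=
    (hu.hasDerivWithinAt ht).hasDerivAt (timeInterval_mem_nhds ht h0)
  have h1 := (hu.hasDerivAt_toL2_velocity ht h0).norm_sq
  have h2 : HasDerivAt (fun s => ‖grad (u s)‖ ^ 2) _ t :=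
    ((gradCLM Ω).hasFDerivAt.comp_hasDerivAt t hd).norm_sq
  have h3 : HasDerivAt (fun s => ‖toL2 (u s)‖ ^ 2) _ t :=
    ((toL2CLM Ω).hasFDerivAt.comp_hasDerivAt t hd).norm_sq
  obtain ⟨L, hL, hLv⟩ := exists_hasFDerivAt_integral_rpow hΩ hp3 hp5 (u t)
  have h4 := hL.comp_hasDerivAt t hd
  have h := (h1.const_mul (1 / 2)).add
    (((((h2.pow 2).const_mul (a / 4)).add (h2.const_mul (b / 2))).sub
      (h3.const_mul (lam / 2))).sub h4)
  refine (h.congr_deriv ?_).congr_of_eventuallyEq (Eventually.of_forall fun s => ?_)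
  · rw [hLv, ← hu.weak_equation ht h0, real_inner_comm (toL2 (velocity T u t))]
    simp only [Function.comp, gradCLM_apply, toL2CLM_apply]
    norm_num
    ring
  · simp only [energy, J, Pi.add_apply, Pi.sub_apply, Pi.pow_apply, Function.comp]
    ring

/-- Conservation of energy. -/
theorem energy_eq (hΩ : Bornology.IsBounded Ω) (hp3 : 3 < p) (hp5 : p < 5)
    (hu : IsSolution a b lam p u₀ u₁ T u) {t : ℝ} (ht : t ∈ timeInterval T) :
    energy a b lam p (u t) (velocity T u t) = energy a b lam p u₀ u₁ := by
  rcases ht.1.eq_or_lt with rfl | h0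
  · rw [hu.init_pos, hu.init_vel]
  have hzero : (0 : ℝ) ∈ timeInterval T := ⟨le_rfl, hu.T_pos⟩
  have hsub : Set.Icc 0 t ⊆ timeInterval T := ordConnected_timeInterval.out hzero ht
  have hcont : ContinuousOn (fun s => energy a b lam p (u s) (velocity T u s))
      (timeInterval T) :=
    (((continuous_toL2.comp_continuousOn hu.continuousOn_velocity).norm.pow 2).const_mul _).add
      ((continuous_J hΩ a b lam hp3 hp5).comp_continuousOn hu.contDiffOn_H10.continuousOn)
  -- The mean value theorem needs the derivative only on `(0, t)`; at time `0`, where the equation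
  -- is not assumed, continuity suffices.
  obtain ⟨c, -, hc⟩ := exists_hasDerivAt_eq_slope _ (fun _ => (0 : ℝ)) h0 (hcont.mono hsub)
    fun s hs => hu.hasDerivAt_energy hΩ hp3 hp5 (hsub (Set.Ioo_subset_Icc_self hs)) hs.1
  rw [eq_comm, div_eq_zero_iff, sub_zero, or_iff_left h0.ne', sub_eq_zero] at hc
  rw [hc, hu.init_pos, hu.init_vel]

end IsSolution

end Energy

end Kirchhoff

/-! ### The uniform bound. -/

theorem theorem2p9 (Ω : Set Kirchhoff.E3) (hΩ : Kirchhoff.IsSmoothBoundedDomain Ω)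
    (a b lam p : ℝ) (ha : 0 < a) (hb : 0 < b) (hp3 : 3 < p) (hp5 : p < 5)
    (hlam : lam ≤ b * Kirchhoff.lambda1 Ω)
    (u₀ u₁ : Kirchhoff.H10 Ω) (hu₀H2 : Kirchhoff.MemH2 u₀)
    (hu₀ : u₀ ∈ Kirchhoff.stableSet Ω a b lam p)
    (hE : Kirchhoff.energy a b lam p u₀ u₁ < Kirchhoff.depth Ω a b lam p)
    (Tmax : EReal) (u : ℝ → Kirchhoff.H10 Ω)
    (hu : Kirchhoff.IsMaximalSolution a b lam p u₀ u₁ Tmax u) :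
    ∃ K₃ : ℝ, 0 < K₃ ∧ ∀ t : ℝ, 0 ≤ t → (t : EReal) < Tmax →
      ‖Kirchhoff.toL2 (Kirchhoff.velocity Tmax u t)‖ + ‖Kirchhoff.grad (u t)‖ ≤ K₃ := by
  have hs := hu.isSolution
  have hbd := hΩ.isBounded
  set E := Kirchhoff.energy a b lam p u₀ u₁
  set c := a * (1 / 4 - 1 / (p + 1))
  have hc : 0 < c := by
    have : 1 / (p + 1) < 1 / 4 := by
      rw [div_lt_div_iff₀ (by linarith) (by norm_num)]; linarith
    exact mul_pos ha (by linarith)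
  have hzero : (0 : ℝ) ∈ Kirchhoff.timeInterval Tmax := ⟨le_rfl, hs.T_pos⟩
  have hen : ∀ t ∈ Kirchhoff.timeInterval Tmax,
      1 / 2 * ‖Kirchhoff.toL2 (Kirchhoff.velocity Tmax u t)‖ ^ 2
        + Kirchhoff.J a b lam p (u t) = E :=
    fun t ht => hs.energy_eq hbd hp3 hp5 ht
  have hJ : ∀ t ∈ Kirchhoff.timeInterval Tmax,
      Kirchhoff.J a b lam p (u t) < Kirchhoff.depth Ω a b lam p := by
    intro t ht
    have := hen t ht
    nlinarith [sq_nonneg ‖Kirchhoff.toL2 (Kirchhoff.velocity Tmax u t)‖]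
  have hbound : ∀ t ∈ Kirchhoff.timeInterval Tmax,
      1 / 2 * ‖Kirchhoff.toL2 (Kirchhoff.velocity Tmax u t)‖ ^ 2
        + c * ‖Kirchhoff.grad (u t)‖ ^ 4 ≤ E := by
    intro t ht
    have hin := Kirchhoff.mem_nehariInside_of_J_lt_depth hbd ha hb hp3 hp5 hlam
      Kirchhoff.ordConnected_timeInterval.isPreconnected hs.contDiffOn_H10.continuousOn hJ hzero
      (hs.init_pos ▸ hu₀.2) ht
    have : c * ‖Kirchhoff.grad (u t)‖ ^ 4 ≤ Kirchhoff.J a b lam p (u t) :=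
      Kirchhoff.le_J_of_I_nonneg hb hp3 hlam
      (Kirchhoff.I_nonneg_of_mem_nehariInside hp3 hin)
    linarith [hen t ht]
  have hE0 : 0 ≤ E := le_trans (by positivity) (hbound 0 hzero)
  -- The constant adds `v ≤ 1 + v² ≤ 1 + 2E` and `g ≤ 1 + g⁴ ≤ 1 + E / c`, where `v = ‖u_t‖₂` and `g
  -- = ‖∇u‖₂`.
  refine ⟨2 + 2 * E + E / c, by positivity, fun t ht0 htT => ?_⟩
  have h := hbound t ⟨ht0, htT⟩
  set v := ‖Kirchhoff.toL2 (Kirchhoff.velocity Tmax u t)‖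
  set g := ‖Kirchhoff.grad (u t)‖
  have h1 : 0 ≤ c * g ^ 4 := by positivity
  have h2 : v ≤ 1 + 2 * E := by nlinarith [sq_nonneg (v - 1), sq_nonneg v]
  have h3 : g ^ 4 ≤ E / c := by
    rw [le_div_iff₀ hc]
    nlinarith [sq_nonneg v]
  have h4 : g ≤ 1 + g ^ 4 := by nlinarith [sq_nonneg (g ^ 2 - 1 / 2), sq_nonneg (g - 1 / 2)]
  linarith
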